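/- Conventions. For a class $\mathcal K$ of objects of an abelian category $\mathcal A$, let $\mathcal K^{\perp}$ be the class of objects $X$ such that $\mathcal A(-,X)$ sends every monomorphism with cokernel in $\mathcal K$ to a surjection, and let ${}^{\perp}\mathcal K$ be the class of objects $X$ such that $\mathcal A(X,-)$ sends every epimorphism with kernel in $\mathcal K$ to a surjection. A pair $(\mathcal X,\mathcal Y)$ of classes of objects of $\mathcal A$ is a cotorsion theory if $\mathcal X={}^{\perp}\mathcal Y$ and $\mathcal Y=\mathcal X^{\perp}$. For such a pair, $\underline{\mathcal Y}$ is the class of those $Y\in\mathcal Y$ such that for every exact sequence $0\to Y\xrightarrow{u} A\to X$ with $X\in\mathcal X$ the morphism $u$ has a retraction. Let $\mathcal A_1,\mathcal A_2,\mathcal A_3$ be abelian categories and let $$T:\mathcal A_1\times\mathcal A_2\to\mathcal A_3,\quad H:\mathcal A_2^{op}\times\mathcal A_3\to\mathcal A_1,\quad C:\mathcal A_1^{op}\times\mathcal A_3\to\mathcal A_2$$ be biadditive functors together with natural isomorphisms $$\mathcal A_3(T(X_1,X_2),X_3)\cong\mathcal A_1(X_1,H(X_2,X_3))\cong\mathcal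 A_2(X_2,C(X_1,X_3))$$ (a biadditive THC-situation, or adjunction of two variables). Assume that $\mathcal A_1$ and $\mathcal A_2$ have all (small) limits and that $\mathcal A_3$ has all (small) colimits. An object $P_1$ of $\mathcal A_1$ (resp. $P_2$ of $\mathcal A_2$) is called flat if $T(P_1,-)$ (resp. $T(-,P_2)$) preserves monomorphisms; $\mathcal F$ denotes the class of flat objects of $\mathcal A_2$. Let $Ch(\mathcal A_i)$ be the category of $\mathbb Z$-indexed chain complexes in $\mathcal A_i$. For complexes $\mathbf C'$ in $\mathcal A_1$ and $\mathbf C$ in $\mathcal A_2$, let $T(\mathbf C',\mathbf C)$ be the complex in $\mathcal A_3$ with $T(\mathbf C',\mathbf C)_n=\bigoplus_{p+q=n}T(\mathbf C'_p,\mathbf C_q)$ whose differential is given on the summand $T(\mathbf C'_p,\mathbf C_q)$ by $T(d'_p,\mathbf C_q)+(-1)^pT(\mathbf C'_p,d_q)$. For an object $E$ of $\mathcal A_1$, let $S^0(E)$ be the complex with $E$ in degree $0$ and $0$ elsewhere. Let $tex(\mathcal F)$ be the class of complexes $\mathbf C$ in $\mathcal A_2$ such that $\mathbf C$ is exact, $\mathbf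 C_n\in\mathcal F$ for all $n\in\mathbb Z$, and $T(S^0(E),\mathbf C)$ is exact for every injective object $E$ of $\mathcal A_1$ (the $F$-totally acyclic complexes). Theorem. Suppose that (1) for $i=1,2$, every object of $\mathcal A_i$ is a quotient of a flat object; (2) $\mathcal A_3$ has enough injective objects; (3) every object of $\mathcal A_2$ is a subobject of an object of $\underline{\mathcal F^{\perp}}$, where the underline is formed with respect to the pair $(\mathcal F,\mathcal F^{\perp})$. Then $(tex(\mathcal F),tex(\mathcal F)^{\perp})$ is a cotorsion theory in $Ch(\mathcal A_2)$. -/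

import Mathlib

open CategoryTheory CategoryTheory.Limits Opposite

universe v v₁ v₂ v₃ u u₁ u₂ u₃

/-! ### Cotorsion theories in an abelian category -/

namespace Cotorsion

variable {A : Type u} [Category.{v} A] [Abelian A]

/-- The class `K^⊥`: the objects `X` such that `A(-, X)` sends every monomorphism
with cokernel in `K` to a surjection. -/
def rightPerp (K : ObjectProperty A) : ObjectProperty A := fun X =>
  ∀ ⦃S : ShortComplex A⦄, S.ShortExact → K S.X₃ →
    Function.Surjective (fun g : S.X₂ ⟶ X => S.f ≫ g)

/-- The class `^⊥K`: the objects `X` such that `A(X, -)` sends every epimorphism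
with kernel in `K` to a surjection. -/
def leftPerp (K : ObjectProperty A) : ObjectProperty A := fun X =>
  ∀ ⦃S : ShortComplex A⦄, S.ShortExact → K S.X₁ →
    Function.Surjective (fun g : X ⟶ S.X₂ => g ≫ S.g)

/-- A cotorsion theory: a pair of classes with `X = ^⊥Y` and `Y = X^⊥`. -/
structure IsCotorsionTheory (X Y : ObjectProperty A) : Prop where
  left_eq : X = leftPerp Y
  right_eq : Y = rightPerp X

/-- The class `\underline{Y}` of a pair `(X, Y)`: the `Y₀ ∈ Y` such that for every exact
sequence `Y₀ ↣ B ⟶ X₀` with `X₀ ∈ X` (the last map need not be an epimorphism), the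
monomorphism `Y₀ ↣ B` has a retraction. -/
def underlineRight (X Y : ObjectProperty A) : ObjectProperty A := fun Y₀ =>
  Y Y₀ ∧ ∀ ⦃B X₀ : A⦄ (i : Y₀ ⟶ B) (p : B ⟶ X₀) (w : i ≫ p = 0),
    Mono i → (ShortComplex.mk i p w).Exact → X X₀ → IsSplitMono i

/-- Every object is a quotient of an object of `P`. -/
def EnoughQuot (P : ObjectProperty A) : Prop :=
  ∀ B : A, ∃ (X : A) (p : X ⟶ B), P X ∧ Epi p

/-- Every object is a subobject of an object of `P`. -/
def EnoughSub (P : ObjectProperty A) : Prop :=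
  ∀ B : A, ∃ (Y : A) (i : B ⟶ Y), P Y ∧ Mono i

/-- The class `ex(P)` of exact chain complexes (indexed by `ℤ`) that are degreewise in `P`. -/
def ex (P : ObjectProperty A) : ObjectProperty (ChainComplex A ℤ) := fun K =>
  K.Acyclic ∧ ∀ n : ℤ, P (K.X n)

end Cotorsion

/-- The signs for total complexes of `ℤ`-indexed chain complexes: the summand of bidegree
`(p, q)` carries the differential `d' ⊗ 1 + (-1)^p (1 ⊗ d)`. -/
instance tensorSignsDownInt : ComplexShape.TensorSigns (ComplexShape.down ℤ) where
  ε' := MonoidHom.mk' Int.negOnePow Int.negOnePow_add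
  rel_add p q r (hpq : q + 1 = p) := by
    change q + r + 1 = p + r
    omega
  add_rel p q r (hpq : q + 1 = p) := by
    change r + q + 1 = r + p
    omega
  ε'_succ p q (hpq : q + 1 = p) := by
    subst hpq
    change q.negOnePow = -(q + 1).negOnePow
    rw [Int.negOnePow_succ, neg_neg]

/-! ### Tensor-hom-cotensor situations -/

/-- A biadditive tensor-hom-cotensor situation (adjunction of two variables): bifunctors
`T : A₁ × A₂ → A₃`, `H : A₂ᵒᵖ × A₃ → A₁`, `C : A₁ᵒᵖ × A₃ → A₂`, written in curried form, with
isomorphisms `A₃(T(X₁, X₂), X₃) ≅ A₁(X₁, H(X₂, X₃))` and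
`A₃(T(X₁, X₂), X₃) ≅ A₂(X₂, C(X₁, X₃))` natural in the three variables. Biadditivity is
required of `T`; by the adjunctions it then holds for `H` and `C`. -/
structure BiadditiveTHC (A₁ : Type u₁) (A₂ : Type u₂) (A₃ : Type u₃)
    [Category.{v₁} A₁] [Category.{v₂} A₂] [Category.{v₃} A₃]
    [Preadditive A₁] [Preadditive A₂] [Preadditive A₃] where
  T : A₁ ⥤ A₂ ⥤ A₃
  H : A₂ᵒᵖ ⥤ A₃ ⥤ A₁
  C : A₁ᵒᵖ ⥤ A₃ ⥤ A₂
  adjH : T.flip ⊣₂ H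
  adjC : T ⊣₂ C
  additive_left : T.Additive
  additive_right : ∀ X₁ : A₁, (T.obj X₁).Additive

namespace BiadditiveTHC

variable {A₁ : Type u₁} {A₂ : Type u₂} {A₃ : Type u₃}
  [Category.{v₁} A₁] [Category.{v₂} A₂] [Category.{v₃} A₃]

instance [Preadditive A₁] [Preadditive A₂] [Preadditive A₃] (S : BiadditiveTHC A₁ A₂ A₃) :
    S.T.Additive := S.additive_left

instance [Preadditive A₁] [Preadditive A₂] [Preadditive A₃] (S : BiadditiveTHC A₁ A₂ A₃)
    (X₁ : A₁) : (S.T.obj X₁).Additive := S.additive_right X₁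

/-- The flat objects `P₁` of `A₁`: `T(P₁, -)` preserves monomorphisms. -/
def flat₁ [Preadditive A₁] [Preadditive A₂] [Preadditive A₃] (S : BiadditiveTHC A₁ A₂ A₃) :
    ObjectProperty A₁ :=
  fun P₁ => (S.T.obj P₁).PreservesMonomorphisms

/-- The flat objects `P₂` of `A₂`: `T(-, P₂)` preserves monomorphisms. -/
def flat₂ [Preadditive A₁] [Preadditive A₂] [Preadditive A₃] (S : BiadditiveTHC A₁ A₂ A₃) :
    ObjectProperty A₂ :=
  fun P₂ => (S.T.flip.obj P₂).PreservesMonomorphisms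

instance [Abelian A₁] [Abelian A₂] [Abelian A₃] [HasColimits A₃] (S : BiadditiveTHC A₁ A₂ A₃)
    (K₁ : ChainComplex A₁ ℤ) (K₂ : ChainComplex A₂ ℤ) :
    HomologicalComplex.HasMapBifunctor K₁ K₂ S.T (ComplexShape.down ℤ) := by
  have : HasColimitsOfSize.{0, 0} A₃ := hasColimitsOfSizeShrink.{0, 0, v₃, v₃} A₃
  intro n
  infer_instance

/-- The tensor of the standard tensor-hom-cotensor situation on chain complexes:
`T(K₁, K₂)ₙ = ⨁_{p + q = n} T((K₁)ₚ, (K₂)_q)`, with differential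
`T(d, 1) + (-1)^p T(1, d)` on the summand of bidegree `(p, q)`. -/
noncomputable def chainT [Abelian A₁] [Abelian A₂] [Abelian A₃] [HasColimits A₃]
    (S : BiadditiveTHC A₁ A₂ A₃) :
    ChainComplex A₁ ℤ ⥤ ChainComplex A₂ ℤ ⥤ ChainComplex A₃ ℤ :=
  S.T.map₂HomologicalComplex (ComplexShape.down ℤ) (ComplexShape.down ℤ) (ComplexShape.down ℤ)

/-- The class `tex(F)` of `F`-totally acyclic complexes: the exact, degreewise flat complexes
`K` in `A₂` such that `T(S⁰(E), K)` is exact for every injective object `E` of `A₁`. -/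
def tex [Abelian A₁] [Abelian A₂] [Abelian A₃] [HasColimits A₃]
    (S : BiadditiveTHC A₁ A₂ A₃) : ObjectProperty (ChainComplex A₂ ℤ) := fun K =>
  Cotorsion.ex S.flat₂ K ∧ ∀ E : A₁, Injective E →
    ((S.chainT.obj ((HomologicalComplex.single A₁ (ComplexShape.down ℤ) 0).obj E)).obj K).Acyclic

end BiadditiveTHC

/-!
Every class is contained in `⊥(class⊥)`, so the theorem says that a complex `X` in `⊥(tex⊥)` is in
`tex`. Such an `X` lifts along every epimorphism with kernel in `tex⊥`, and by adjunction `tex⊥`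
contains three families of complexes, one for each condition in the definition of `tex`.

* The discs on `Y` in `F⊥`, because evaluation at a degree is left adjoint to the disc. Hence each
  `Xₙ` lies in `⊥(F⊥)`, and this is `F`: the objects `C(Q, I)` with `I` injective lie in `F⊥`, and
  for a monomorphism `M ⟶ N`, lifting along `C(N, I) ⟶ C(M, I)` shows that
  `T(M, Xₙ) ⟶ T(N, Xₙ)` is a monomorphism.
* The spheres on `Y` in the underlined class of `F⊥`, because the sphere is right adjoint to the
  quotient `Zₙ = Kₙ / im d` of a complex `K`. When `K` is in `tex`, `Zₙ` is merely a subobject of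
  the flat object `Kₙ₋₁`, which is why the underlined class is needed.
* The spheres on `C(E, I)` with `E` and `I` injective, by the same adjunction applied after
  `T(E, -)`.

A sphere in degree `n - 1` is the kernel of the epimorphism from a disc to the sphere in degree `n`.
Lifting a map from a complex `L` to the latter extends a map from `Zₙ` along `Zₙ ⟶ Lₙ₋₁`. Embedding
`Zₙ` into an object of the class at hand makes this map a monomorphism, which is exactness in
degree `n`. With `L = X` and `L = T(E, X)` this yields the two exactness conditions.

That `C(Q, I)` lies in `F⊥`, and the third family in `tex⊥`, rests on `T(Q, -)` preserving
monomorphisms with flat cokernel, for all `Q`: choose an epimorphism from a flat object to `Q` and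
chase the resulting diagram.
-/

namespace Cotorsion

section EnoughSub

variable {A : Type*} [Category* A]

lemma EnoughSub.mono {P Q : ObjectProperty A} (hP : EnoughSub P) (hPQ : P ≤ Q) : EnoughSub Q :=
  fun B =>
    have ⟨Y, m, hY, hm⟩ := hP B
    ⟨Y, m, hPQ Y hY, hm⟩

variable (A) in
lemma enoughSub_injective [EnoughInjectives A] :
    EnoughSub (fun I : A => Injective I) :=
  fun B => ⟨_, Injective.ι B, inferInstance, inferInstance⟩

end EnoughSub

section Abelian

variable {A : Type*} [Category* A] [Abelian A]

lemma le_leftPerp_rightPerp (K : ObjectProperty A) : K ≤ leftPerp (rightPerp K) := by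
  intro X hX S hS hY f
  have := hS.mono_f
  have := hS.epi_g
  let e : kernel (pullback.snd S.g f) ⟶ S.X₁ :=
    hS.exact.lift (kernel.ι _ ≫ pullback.fst S.g f) (by simp [pullback.condition])
  have he : e ≫ S.f = kernel.ι _ ≫ pullback.fst S.g f := hS.exact.lift_f _ _
  let P := ShortComplex.mk _ _ (kernel.condition (pullback.snd S.g f))
  have hP : P.ShortExact :=
    .mk' (ShortComplex.kernelSequence_exact _) inferInstance inferInstance
  obtain ⟨r, hr : kernel.ι _ ≫ r = e⟩ := hY hP hX e
  let s : X ⟶ S.X₂ := hP.exact.desc (pullback.fst S.g f - r ≫ S.f) (by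
    simp [P, reassoc_of% hr, he])
  have hs : pullback.snd S.g f ≫ s = pullback.fst S.g f - r ≫ S.f := hP.exact.g_desc _ _
  refine ⟨s, ?_⟩
  rw [← cancel_epi (pullback.snd S.g f)]
  simp [reassoc_of% hs, pullback.condition]

lemma isCotorsionTheory_rightPerp {K : ObjectProperty A} (hK : leftPerp (rightPerp K) ≤ K) :
    IsCotorsionTheory K (rightPerp K) :=
  ⟨le_antisymm (le_leftPerp_rightPerp K) hK, rfl⟩

lemma exists_extension_of_underlineRight {X Y : ObjectProperty A} {Y₀ : A}
    (hY₀ : underlineRight X Y Y₀) {S : ShortComplex A} (hS : S.Exact) [Mono S.f]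
    (h₃ : X S.X₃) (φ : S.X₁ ⟶ Y₀) : ∃ ψ : S.X₂ ⟶ Y₀, S.f ≫ ψ = φ := by
  let P := ShortComplex.mk (pushout.inr S.f φ) (pushout.desc S.g 0 (by simp))
    (pushout.inr_desc _ _ _)
  have hP : P.Exact := by
    have hpush := IsPushout.of_hasPushout S.f φ
    have := isIso_cokernel_map_of_isPushout hpush
    have := S.exact_iff_mono_cokernel_desc.1 hS
    have fac : cokernel.map S.f P.f φ (pushout.inl S.f φ) hpush.w ≫
        cokernel.desc P.f P.g P.zero = cokernel.desc S.f S.g S.zero := by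
      ext
      simpa [P] using pushout.inl_desc _ _ _
    rw [P.exact_iff_mono_cokernel_desc, ← IsIso.inv_comp_eq .. |>.2 fac.symm]
    infer_instance
  have := hY₀.2 P.f P.g P.zero inferInstance hP h₃
  exact ⟨pushout.inl S.f φ ≫ retraction P.f, by
    rw [pushout.condition_assoc, IsSplitMono.id P.f, Category.comp_id]⟩

end Abelian

section Adjunction

variable {A B : Type*} [Category* A] [Category* B] [Abelian A] {L : A ⥤ B} {R : B ⥤ A}

lemma rightPerp_obj_of_adjunction (adj : L ⊣ R) {K : ObjectProperty A} {Y : B}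
    (hY : ∀ ⦃S : ShortComplex A⦄, S.ShortExact → K S.X₃ → ∀ φ : L.obj S.X₁ ⟶ Y,
      ∃ ψ : L.obj S.X₂ ⟶ Y, L.map S.f ≫ ψ = φ) :
    rightPerp K (R.obj Y) := by
  intro S hS hX φ
  obtain ⟨ψ, hψ⟩ := hY hS hX ((adj.homEquiv _ _).symm φ)
  exact ⟨adj.homEquiv _ _ ψ, by
    simp [← adj.homEquiv_naturality_left, hψ]⟩

lemma exists_lift_of_adjunction [Preadditive B] [R.PreservesZeroMorphisms]
    (adj : L ⊣ R) {K : ObjectProperty A} {X : A}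
    (hX : leftPerp K X) {S : ShortComplex B} (hS : (S.map R).ShortExact) (hK : K (R.obj S.X₁))
    (φ : L.obj X ⟶ S.X₃) : ∃ ψ : L.obj X ⟶ S.X₂, ψ ≫ S.g = φ := by
  obtain ⟨ψ : X ⟶ R.obj S.X₂, hψ : ψ ≫ R.map S.g = _⟩ := hX hS hK (adj.homEquiv _ _ φ)
  exact ⟨(adj.homEquiv _ _).symm ψ, by
    simp [← adj.homEquiv_naturality_right_symm, hψ]⟩

end Adjunction

section ThreeByThree

variable {A : Type*} [Category* A] [Abelian A]

lemma mono_f_of_columns_exact {L₁ L₂ L₃ : ShortComplex A} (φ : L₁ ⟶ L₂) (ψ : L₂ ⟶ L₃)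
    (w₁ : φ.τ₁ ≫ ψ.τ₁ = 0) (w₂ : φ.τ₂ ≫ ψ.τ₂ = 0) (h₂ : (ShortComplex.mk φ.τ₂ ψ.τ₂ w₂).Exact)
    (hL₁ : L₁.Exact) [Mono L₂.f] [Mono φ.τ₃] [Epi ψ.τ₁] : Mono L₃.f := by
  refine Preadditive.mono_of_cancel_zero _ fun {B} x hx => ?_
  obtain ⟨B₁, π₁, _, a, ha⟩ := surjective_up_to_refinements_of_epi ψ.τ₁ x
  obtain ⟨B₂, π₂, _, b, hb : π₂ ≫ a ≫ L₂.f = b ≫ φ.τ₂⟩ := h₂.exact_up_to_refinements (a ≫ L₂.f) (by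
    dsimp
    rw [Category.assoc, ← ψ.comm₁₂, ← reassoc_of% ha, hx, comp_zero])
  obtain ⟨B₃, π₃, _, a', ha'⟩ := hL₁.exact_up_to_refinements b (by
    rw [← cancel_mono φ.τ₃, Category.assoc, ← φ.comm₂₃, ← reassoc_of% hb]
    simp)
  have h : π₃ ≫ π₂ ≫ a = a' ≫ φ.τ₁ := by
    rw [← cancel_mono L₂.f]
    simp [hb, reassoc_of% ha', φ.comm₁₂]
  rw [← cancel_epi π₁, ← cancel_epi π₂, ← cancel_epi π₃, ha, reassoc_of% h, w₁]
  simp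

end ThreeByThree

open HomologicalComplex

section Disc

variable {A : Type*} [Category* A] [HasZeroMorphisms A] [HasZeroObject A]
  {ι : Type*} {c : ComplexShape ι} {i j : ι} (hij : c.Rel i j) (h : i ≠ j)

open scoped Classical in
/-- The morphism to the complex `Y = Y` in degrees `i` and `j` with component `φ` in degree `j`;
the other component is forced to be `K.d i j ≫ φ`. -/
noncomputable def mkHomToDisc {K : HomologicalComplex A c} {Y : A} (φ : K.X j ⟶ Y) :
    K ⟶ double (𝟙 Y) hij where
  f k :=
    if hi : k = i then
      eqToHom (by rw [hi]) ≫ (K.d i j ≫ φ) ≫ (doubleXIso₀ (𝟙 Y) hij).inv ≫ eqToHom (by rw [hi])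
    else if hj : k = j then
      eqToHom (by rw [hj]) ≫ φ ≫ (doubleXIso₁ (𝟙 Y) hij h).inv ≫ eqToHom (by rw [hj])
    else 0
  comm' k l hkl := by
    by_cases hl : l = j
    · subst hl
      obtain rfl := c.prev_eq hkl hij
      simp [h.symm, double_d _ _ h]
    · rw [double_d_eq_zero₁ _ _ _ _ hl, comp_zero]
      by_cases hl' : l = i
      · subst hl'
        simp
      · simp [hl, hl']

@[simp]
lemma mkHomToDisc_f_left {K : HomologicalComplex A c} {Y : A} (φ : K.X j ⟶ Y) :
    (mkHomToDisc hij h φ).f i = K.d i j ≫ φ ≫ (doubleXIso₀ (𝟙 Y) hij).inv := by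
  simp [mkHomToDisc]

@[simp]
lemma mkHomToDisc_f_right {K : HomologicalComplex A c} {Y : A} (φ : K.X j ⟶ Y) :
    (mkHomToDisc hij h φ).f j = φ ≫ (doubleXIso₁ (𝟙 Y) hij h).inv := by
  simp [mkHomToDisc, h.symm]

include h in
lemma isIso_double_id_d (Y : A) : IsIso ((double (𝟙 Y) hij).d i j) := by
  rw [double_d _ _ h]
  infer_instance

include h in
lemma to_disc_hom_ext {K : HomologicalComplex A c} {Y : A} {f g : K ⟶ double (𝟙 Y) hij}
    (hfg : f.f j = g.f j) : f = g := by
  have := isIso_double_id_d hij h Y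
  refine to_double_hom_ext ?_ hfg
  rw [← cancel_mono ((double (𝟙 Y) hij).d i j), f.comm, g.comm, hfg]

lemma epi_mkHomToDisc {K : HomologicalComplex A c} {Y : A} (φ : K.X j ⟶ Y) [Epi φ]
    [Epi (K.d i j)] : Epi (mkHomToDisc hij h φ) where
  left_cancellation a b hab := from_double_hom_ext
    (by simpa [cancel_epi] using congr_hom hab i) (by simpa [cancel_epi] using congr_hom hab j)

/-- Morphisms from a complex to a disc correspond to morphisms from its component in the lower of
the two degrees. -/
@[simps]
noncomputable def homToDiscEquiv (K : HomologicalComplex A c) (Y : A) :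
    (K.X j ⟶ Y) ≃ (K ⟶ double (𝟙 Y) hij) where
  toFun φ := mkHomToDisc hij h φ
  invFun ψ := ψ.f j ≫ (doubleXIso₁ (𝟙 Y) hij h).hom
  left_inv φ := by simp
  right_inv ψ := to_disc_hom_ext hij h (by simp)

lemma homToDiscEquiv_comp {K L : HomologicalComplex A c} {Y : A} (f : K ⟶ L) (φ : L.X j ⟶ Y) :
    homToDiscEquiv hij h K Y (f.f j ≫ φ) = f ≫ homToDiscEquiv hij h L Y φ :=
  to_disc_hom_ext hij h (by simp)

/-- The functor sending `Y` to the disc `Y = Y` in degrees `i` and `j`. -/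
noncomputable def disc : A ⥤ HomologicalComplex A c :=
  Adjunction.rightAdjointOfEquiv (F := eval A c j) (homToDiscEquiv hij h)
    fun _ _ _ f φ => homToDiscEquiv_comp hij h f φ

/-- A morphism from a complex to a disc is determined by its component in the lower degree. -/
noncomputable def evalDiscAdjunction : eval A c j ⊣ disc hij h :=
  Adjunction.adjunctionOfEquivRight _ _

lemma disc_map {Y Z : A} (f : Y ⟶ Z) :
    (disc hij h).map f = mkHomToDisc hij h ((doubleXIso₁ (𝟙 Y) hij h).hom ≫ f) :=
  congrArg (mkHomToDisc hij h (K := double (𝟙 Y) hij))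
    (show ((𝟙 (double (𝟙 Y) hij) : _ ⟶ _).f j ≫ (doubleXIso₁ (𝟙 Y) hij h).hom) ≫ f = _ by simp)

instance : (disc (A := A) hij h).PreservesEpimorphisms where
  preserves {Y _} f _ := by
    have := isIso_double_id_d hij h Y
    rw [disc_map]
    exact epi_mkHomToDisc (K := double (𝟙 Y) hij) hij h ((doubleXIso₁ (𝟙 Y) hij h).hom ≫ f)

end Disc

section DiscExact

variable {A : Type*} [Category* A] [Abelian A]
  {ι : Type*} {c : ComplexShape ι} {i j : ι} (hij : c.Rel i j) (h : i ≠ j)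

instance : (disc (A := A) hij h).Additive := (evalDiscAdjunction hij h).right_adjoint_additive

lemma shortExact_map_disc {S : ShortComplex A} (hS : S.ShortExact) :
    (S.map (disc hij h)).ShortExact := by
  have := (evalDiscAdjunction (A := A) hij h).rightAdjoint_preservesLimits
  have := hS.mono_f
  have := hS.epi_g
  have : Mono ((disc hij h).map S.f) := inferInstance
  have : Epi ((disc hij h).map S.g) := inferInstance
  exact .mk' (hS.exact.map_of_mono_of_preservesKernel _ inferInstance inferInstance) ‹_› ‹_›

lemma rightPerp_disc {F : ObjectProperty A} {K : ObjectProperty (HomologicalComplex A c)}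
    (hK : ∀ X, K X → F (X.X j)) {Y : A} (hY : rightPerp F Y) :
    rightPerp K ((disc hij h).obj Y) :=
  rightPerp_obj_of_adjunction (evalDiscAdjunction hij h) fun _ hS hX φ =>
    hY (hS.map_of_exact (eval A c j)) (hK _ hX) φ

lemma leftPerp_X_of_disc {F : ObjectProperty A} {K : ObjectProperty (HomologicalComplex A c)}
    (hK : ∀ Y, F Y → K ((disc hij h).obj Y)) {X : HomologicalComplex A c} (hX : leftPerp K X) :
    leftPerp F (X.X j) := fun _ hS hY φ =>
  exists_lift_of_adjunction (evalDiscAdjunction hij h) hX (shortExact_map_disc hij h hS)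
    (hK _ hY) φ

end DiscExact

section SphereDisc

variable {A : Type*} [Category* A] [Preadditive A] [HasZeroObject A]
  {ι : Type*} [DecidableEq ι] {c : ComplexShape ι} {i j : ι} (hij : c.Rel i j) (h : i ≠ j)

/-- The sequence `S ⟶ D ⟶ S'` where `D` is the disc `Y = Y` in degrees `i` and `j`, and `S`, `S'`
are the complexes with `Y` in the single degree `j`, respectively `i`. -/
@[simps]
noncomputable def sphereDisc (Y : A) : ShortComplex (HomologicalComplex A c) where
  X₁ := (single A c j).obj Y
  X₂ := double (𝟙 Y) hij
  X₃ := (single A c i).obj Y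
  f := mkHomToDisc hij h (singleObjXSelf c j Y).hom
  g := mkHomFromDouble hij h (singleObjXSelf c i Y).inv 0 (by simp) (by simp)
  zero := from_single_hom_ext (by simp)

-- In each degree one of the two maps is an isomorphism and the third object is zero.
lemma nonempty_splitting_sphereDisc_map_eval (Y : A) (k : ι) :
    Nonempty ((sphereDisc hij h Y).map (eval A c k)).Splitting := by
  by_cases hj : k = j
  · subst hj
    have : IsIso ((mkHomToDisc hij h (singleObjXSelf c k Y).hom).f k) := by
      rw [mkHomToDisc_f_right]
      infer_instance
    exact ⟨.ofIsIsoOfIsZero _ this (isZero_single_obj_X c i Y k h.symm)⟩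
  · have : IsIso ((sphereDisc hij h Y).g.f k) := by
      by_cases hi : k = i
      · subst hi
        rw [sphereDisc_g, mkHomFromDouble_f₀]
        exact ((doubleXIso₀ (𝟙 Y) hij) ≪≫ (singleObjXSelf c k Y).symm).isIso_hom
      · exact (isZero_double_X _ hij k hi hj).isIso (isZero_single_obj_X c i Y k hi) _
    exact ⟨.ofIsZeroOfIsIso _ (isZero_single_obj_X c j Y k hj) this⟩

lemma shortExact_map_sphereDisc {B : Type*} [Category* B] [Abelian B] (R : A ⥤ B) [R.Additive]
    (Y : A) : ((sphereDisc hij h Y).map (R.mapHomologicalComplex c)).ShortExact := by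
  refine shortExact_of_degreewise_shortExact _ fun k => ?_
  obtain ⟨s⟩ := nonempty_splitting_sphereDisc_map_eval hij h Y k
  exact (s.map R).shortExact

end SphereDisc

section Opcycles

variable {A : Type*} [Category* A] [Abelian A] {ι : Type*} {c : ComplexShape ι}

lemma exactAt_iff_mono_fromOpcycles (K : HomologicalComplex A c) {i j : ι} (hij : c.Rel i j) :
    K.ExactAt i ↔ Mono (K.fromOpcycles i j) := by
  have hK := K.homologyIsKernel i j (c.next_eq' hij)
  rw [K.exactAt_iff_isZero_homology]
  exact ⟨Preadditive.mono_of_isZero_kernel' _ hK, fun _ => KernelFork.IsLimit.isZero_of_mono hK⟩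

lemma mono_opcyclesMap {S : ShortComplex (HomologicalComplex A c)} (hS : S.ShortExact) {i j : ι}
    (hij : c.Rel i j) (h : S.X₃.ExactAt i) : Mono (opcyclesMap S.f j) := by
  have hH : Mono (homologyMap S.f j) := (hS.homology_exact₁ i j hij).mono_g
    ((S.X₃.exactAt_iff_isZero_homology i).1 h |>.eq_of_src _ _)
  have hf : Mono (S.f.f (c.next j)) := by
    have := hS.mono_f
    infer_instance
  refine Preadditive.mono_of_cancel_zero _ fun {B} x hx => ?_
  have hx₀ : x ≫ S.X₁.fromOpcycles j (c.next j) = 0 := by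
    have comm : S.X₁.fromOpcycles j (c.next j) ≫ S.f.f (c.next j) =
        opcyclesMap S.f j ≫ S.X₂.fromOpcycles j (c.next j) := by
      simp [← cancel_epi (pOpcycles _ j)]
    rw [← cancel_mono (S.f.f (c.next j)), Category.assoc, comm, reassoc_of% hx, zero_comp,
      zero_comp]
  obtain ⟨y, rfl⟩ := KernelFork.IsLimit.lift' (S.X₁.homologyIsKernel j _ rfl) x hx₀
  have hy : y = 0 := by
    rw [← cancel_mono (homologyMap S.f j), ← cancel_mono (S.X₂.homologyι j)]
    simpa using hx
  simp [hy]

variable [DecidableEq ι] (n : ι)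

/-- Morphisms from a complex `K` to a complex concentrated in degree `n` are the morphisms out of
the quotient of `K.X n` by the boundaries. -/
@[simps]
noncomputable def opcyclesHomEquiv (K : HomologicalComplex A c) (Y : A) :
    (K.opcycles n ⟶ Y) ≃ (K ⟶ (single A c n).obj Y) where
  toFun φ := mkHomToSingle (K.pOpcycles n ≫ φ) (by simp)
  invFun ψ := K.descOpcycles (ψ.f n ≫ (singleObjXSelf c n Y).hom) _ rfl (by simp [← ψ.comm_assoc])
  left_inv φ := by simp [← cancel_epi (K.pOpcycles n)]
  right_inv ψ := to_single_hom_ext (by simp)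

lemma opcyclesHomEquiv_symm_comp {K L : HomologicalComplex A c} {Y : A} (f : K ⟶ L)
    (ψ : L ⟶ (single A c n).obj Y) :
    (opcyclesHomEquiv n K Y).symm (f ≫ ψ) = opcyclesMap f n ≫ (opcyclesHomEquiv n L Y).symm ψ := by
  simp

lemma opcyclesHomEquiv_comp {K : HomologicalComplex A c} {Y Z : A} (φ : K.opcycles n ⟶ Y)
    (g : Y ⟶ Z) :
    opcyclesHomEquiv n K Z (φ ≫ g) = opcyclesHomEquiv n K Y φ ≫ (single A c n).map g :=
  to_single_hom_ext (by simp [single_map_f_self])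

/-- The functor `single A c n` is right adjoint to the quotient of degree `n` by the boundaries. -/
noncomputable def opcyclesSingleAdjunction : opcyclesFunctor A c n ⊣ single A c n :=
  Adjunction.mkOfHomEquiv
    { homEquiv := opcyclesHomEquiv n
      homEquiv_naturality_left_symm := opcyclesHomEquiv_symm_comp n
      homEquiv_naturality_right := opcyclesHomEquiv_comp n }

end Opcycles

section MapAdjunction

variable {A B : Type*} [Category* A] [Category* B] [Preadditive A] [Preadditive B]
  {G : A ⥤ B} {R : B ⥤ A} [G.Additive] [R.Additive] {ι : Type*}

/-- An adjunction between additive functors, applied degreewise to complexes. -/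
noncomputable def mapHomologicalComplexAdjunction (adj : G ⊣ R) (c : ComplexShape ι) :
    G.mapHomologicalComplex c ⊣ R.mapHomologicalComplex c where
  unit :=
    { app := fun K =>
        { f := fun n => adj.unit.app (K.X n)
          comm' := fun _ _ _ => (adj.unit.naturality _).symm }
      naturality := fun _ _ f => Hom.ext (funext fun n => adj.unit.naturality (f.f n)) }
  counit :=
    { app := fun K =>
        { f := fun n => adj.counit.app (K.X n)
          comm' := fun _ _ _ => (adj.counit.naturality _).symm }
      naturality := fun _ _ f => Hom.ext (funext fun n => adj.counit.naturality (f.f n)) }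
  left_triangle_components K := Hom.ext (funext fun n => adj.left_triangle_components (K.X n))
  right_triangle_components K := Hom.ext (funext fun n => adj.right_triangle_components (K.X n))

end MapAdjunction

section Exactness

variable {A : Type*} [Category* A] [Abelian A] {ι : Type*} [DecidableEq ι]
  {c : ComplexShape ι} {i j : ι}

lemma exactAt_of_forall_exists_lift (hij : c.Rel i j) (h : i ≠ j) (L : HomologicalComplex A c)
    {P : ObjectProperty A} (hP : EnoughSub P)
    (hL : ∀ Y, P Y → ∀ φ : L ⟶ (single A c i).obj Y, ∃ ψ, ψ ≫ (sphereDisc hij h Y).g = φ) :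
    L.ExactAt i := by
  obtain ⟨Y, m, hY, _⟩ := hP (L.opcycles i)
  obtain ⟨ψ : L ⟶ double (𝟙 Y) hij,
    hψ : ψ ≫ mkHomFromDouble hij h (singleObjXSelf c i Y).inv 0 (by simp) (by simp) = _⟩ :=
      hL Y hY (opcyclesHomEquiv i L Y m)
  have hψi : ψ.f i ≫ (doubleXIso₀ (𝟙 Y) hij).hom = L.pOpcycles i ≫ m := by
    rw [← cancel_mono (singleObjXSelf c i Y).inv]
    simpa using congr_hom hψ i
  have hm : L.fromOpcycles i j ≫ ψ.f j ≫ (doubleXIso₁ (𝟙 Y) hij h).hom = m := by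
    rw [← cancel_epi (L.pOpcycles i), ← hψi, p_fromOpcycles_assoc, ← ψ.comm_assoc]
    simp [double_d _ _ h]
  rw [exactAt_iff_mono_fromOpcycles L hij]
  exact mono_of_mono_fac hm

lemma exactAt_map_of_leftPerp {B : Type*} [Category* B] [Abelian B] {G : A ⥤ B} {R : B ⥤ A}
    [G.Additive] [R.Additive] (adj : G ⊣ R) (hij : c.Rel i j) (h : i ≠ j)
    {K : ObjectProperty (HomologicalComplex A c)} {X : HomologicalComplex A c}
    (hX : leftPerp K X)
    (hK : EnoughSub fun Y => K ((R.mapHomologicalComplex c).obj ((single B c j).obj Y))) :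
    ((G.mapHomologicalComplex c).obj X).ExactAt i :=
  exactAt_of_forall_exists_lift hij h _ hK fun Y hY φ =>
    exists_lift_of_adjunction (mapHomologicalComplexAdjunction adj c) hX
      (shortExact_map_sphereDisc hij h R Y) hY φ

end Exactness

section Spheres

variable {A : Type*} [Category* A] [Abelian A] {ι : Type*} [DecidableEq ι] {c : ComplexShape ι}
  {i j k : ι} {K : ObjectProperty (HomologicalComplex A c)}

lemma rightPerp_single_of_underlineRight (hij : c.Rel i j) (hjk : c.Rel j k)
    (hKi : ∀ X, K X → X.ExactAt i) (hKj : ∀ X, K X → X.ExactAt j) {F F' : ObjectProperty A}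
    (hKF : ∀ X, K X → F (X.X k)) {Y : A} (hY : underlineRight F F' Y) :
    rightPerp K ((single A c j).obj Y) :=
  rightPerp_obj_of_adjunction (opcyclesSingleAdjunction j) fun S hS hX φ => by
    have := hS.epi_g
    have := mono_opcyclesMap hS hij (hKi _ hX)
    have := (exactAt_iff_mono_fromOpcycles _ hjk).1 (hKj _ hX)
    let Q := ShortComplex.mk (opcyclesMap S.f j) (opcyclesMap S.g j)
      (by rw [← opcyclesMap_comp, S.zero, opcyclesMap_zero])
    let Q' := ShortComplex.mk Q.f (Q.g ≫ S.X₃.fromOpcycles j k) (by rw [Q.zero_assoc, zero_comp])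
    let α : Q ⟶ Q' := { τ₁ := 𝟙 _, τ₂ := 𝟙 _, τ₃ := S.X₃.fromOpcycles j k }
    have hQ' : Q'.Exact := (ShortComplex.exact_iff_of_epi_of_isIso_of_mono α).1
      (opcycles_right_exact S hS.exact j)
    exact exists_extension_of_underlineRight hY hQ' (hKF _ hX) φ

lemma rightPerp_map_single_of_injective {B : Type*} [Category* B] [Abelian B] {G : A ⥤ B}
    {R : B ⥤ A} [G.Additive] [R.Additive] (adj : G ⊣ R) (hij : c.Rel i j)
    (hKG : ∀ ⦃S : ShortComplex (HomologicalComplex A c)⦄, S.ShortExact → K S.X₃ →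
      (S.map (G.mapHomologicalComplex c)).ShortExact)
    (hKi : ∀ X, K X → ((G.mapHomologicalComplex c).obj X).ExactAt i) (I : B) [Injective I] :
    rightPerp K ((R.mapHomologicalComplex c).obj ((single B c j).obj I)) :=
  rightPerp_obj_of_adjunction
    ((mapHomologicalComplexAdjunction adj c).comp (opcyclesSingleAdjunction j))
    fun S hS hX (φ : (S.map (G.mapHomologicalComplex c)).X₁.opcycles j ⟶ I) =>
      have := mono_opcyclesMap (hKG hS hX) hij (hKi _ hX)
      Injective.factors φ (opcyclesMap (S.map (G.mapHomologicalComplex c)).f j)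

end Spheres

section MapBifunctorSingle

variable {A₁ A₂ A₃ : Type*} [Category* A₁] [Category* A₂] [Category* A₃]
  [HasZeroMorphisms A₁] [HasZeroObject A₁] [HasZeroMorphisms A₂] [Preadditive A₃]
  {ι : Type*} [DecidableEq ι] [AddMonoid ι] {c : ComplexShape ι} [c.TensorSigns]
  (T : A₁ ⥤ A₂ ⥤ A₃) [T.PreservesZeroMorphisms] [∀ X, (T.obj X).PreservesZeroMorphisms]
  (E : A₁) (K : HomologicalComplex A₂ c)
  [HasMapBifunctor ((single A₁ c 0).obj E) K T c]

/-- The inclusion of the summand of bidegree `(0, n)` into the degree `n` component of the total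
complex `T(S⁰(E), K)`. -/
noncomputable def ιMapBifunctorSingle (n : ι) :
    (T.obj E).obj (K.X n) ⟶ (mapBifunctor ((single A₁ c 0).obj E) K T c).X n :=
  (T.map (singleObjXSelf c 0 E).inv).app (K.X n) ≫
    ιMapBifunctor ((single A₁ c 0).obj E) K T c 0 n n (zero_add n)

open scoped Classical in
/-- The projection of the degree `n` component of the total complex `T(S⁰(E), K)` onto its summand
of bidegree `(0, n)`. -/
noncomputable def πMapBifunctorSingle (n : ι) :
    (mapBifunctor ((single A₁ c 0).obj E) K T c).X n ⟶ (T.obj E).obj (K.X n) :=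
  mapBifunctorDesc fun p q hpq =>
    if hp : p = 0 then
      (T.map (singleObjXIsoOfEq c 0 E p hp).hom).app (K.X q) ≫
        (T.obj E).map (K.XIsoOfEq (by subst hp; exact (zero_add q).symm.trans hpq)).hom
    else 0

/-- The only nonzero summand of the degree `n` component of `T(S⁰(E), K)` is that of bidegree
`(0, n)`. -/
@[simps]
noncomputable def mapBifunctorSingleXIso (n : ι) :
    (T.obj E).obj (K.X n) ≅ (mapBifunctor ((single A₁ c 0).obj E) K T c).X n where
  hom := ιMapBifunctorSingle T E K n
  inv := πMapBifunctorSingle T E K n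
  hom_inv_id := by
    simp [ιMapBifunctorSingle, πMapBifunctorSingle, singleObjXSelf]
  inv_hom_id := by
    refine mapBifunctor.hom_ext fun p q hpq => ?_
    by_cases hp : p = 0
    · subst hp
      obtain rfl : q = n := (zero_add q).symm.trans hpq
      simp [ιMapBifunctorSingle, πMapBifunctorSingle, singleObjXSelf,
        ← NatTrans.comp_app_assoc, ← Functor.map_comp]
    · have hzero : IsZero ((T.obj (((single A₁ c 0).obj E).X p)).obj (K.X q)) :=
        (T.flip.obj (K.X q)).map_isZero (isZero_single_obj_X c 0 E p hp)
      exact hzero.eq_of_src _ _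

lemma ιMapBifunctorSingle_d (m n : ι) :
    ιMapBifunctorSingle T E K m ≫ (mapBifunctor ((single A₁ c 0).obj E) K T c).d m n =
      (T.obj E).map (K.d m n) ≫ ιMapBifunctorSingle T E K n := by
  by_cases hmn : c.Rel m n
  · have h₁ : mapBifunctor.d₁ ((single A₁ c 0).obj E) K T c 0 m n = 0 := by
      by_cases h₀ : c.Rel 0 (c.next 0)
      · rw [mapBifunctor.d₁_eq' _ _ _ _ h₀]
        simp
      · exact mapBifunctor.d₁_eq_zero _ _ _ _ _ _ _ h₀
    have h₂ : mapBifunctor.d₂ ((single A₁ c 0).obj E) K T c 0 m n =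
        (T.obj _).map (K.d m n) ≫
          ιMapBifunctor ((single A₁ c 0).obj E) K T c 0 n n (zero_add n) := by
      rw [mapBifunctor.d₂_eq _ _ _ _ _ hmn _ (zero_add n)]
      simp
    rw [ιMapBifunctorSingle, ιMapBifunctorSingle, Category.assoc, mapBifunctor.d_eq,
      Preadditive.comp_add, mapBifunctor.ι_D₁, mapBifunctor.ι_D₂, h₁, h₂, zero_add]
    simp
  · simp [hmn]

/-- The total complex `T(S⁰(E), K)` is `T(E, -)` applied degreewise to `K`. -/
noncomputable def mapBifunctorSingleIso :
    ((T.obj E).mapHomologicalComplex c).obj K ≅ mapBifunctor ((single A₁ c 0).obj E) K T c :=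
  Hom.isoOfComponents (mapBifunctorSingleXIso T E K)
    fun m n _ => ιMapBifunctorSingle_d T E K m n

end MapBifunctorSingle

end Cotorsion

namespace BiadditiveTHC

section Preadditive

variable {A₁ : Type u₁} {A₂ : Type u₂} {A₃ : Type u₃}
  [Category.{v₁} A₁] [Category.{v₂} A₂] [Category.{v₃} A₃]
  [Preadditive A₁] [Preadditive A₂] [Preadditive A₃] (S : BiadditiveTHC A₁ A₂ A₃)

instance (X₂ : A₂) : (S.T.flip.obj X₂).Additive where

instance (X₁ : A₁) : (S.T.obj X₁).IsLeftAdjoint := (S.adjC.adj X₁).isLeftAdjoint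

instance (X₂ : A₂) : (S.T.flip.obj X₂).IsLeftAdjoint := (S.adjH.adj X₂).isLeftAdjoint

instance (X₁ : A₁) : (S.C.obj (op X₁)).Additive := (S.adjC.adj X₁).right_adjoint_additive

instance (X₃ : A₃) : PreservesFiniteLimits (S.C.flip.obj X₃) where
  preservesFiniteLimits J _ _ := S.adjC.preservesLimitsOfShape_flip_obj J X₃

end Preadditive

variable {A₁ : Type u₁} {A₂ : Type u₂} {A₃ : Type u₃}
  [Category.{v₁} A₁] [Category.{v₂} A₂] [Category.{v₃} A₃]
  [Abelian A₁] [Abelian A₂] [Abelian A₃] (S : BiadditiveTHC A₁ A₂ A₃)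

open HomologicalComplex

section Flat

lemma mono_T_map_of_flat₂ (hflat₁ : Cotorsion.EnoughQuot S.flat₁) {P : ShortComplex A₂}
    (hP : P.ShortExact) (h₃ : S.flat₂ P.X₃) (Q : A₁) : Mono ((S.T.obj Q).map P.f) := by
  have := hP.mono_f
  have := hP.epi_g
  obtain ⟨F, p, hF, hp⟩ := hflat₁ Q
  have hF' : (S.T.obj F).PreservesMonomorphisms := hF
  have h₃' : (S.T.flip.obj P.X₃).PreservesMonomorphisms := h₃
  let φ : P.map (S.T.obj (kernel p)) ⟶ P.map (S.T.obj F) := P.mapNatTrans (S.T.map (kernel.ι p))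
  let ψ : P.map (S.T.obj F) ⟶ P.map (S.T.obj Q) := P.mapNatTrans (S.T.map p)
  have hφψ (X : A₂) : (S.T.map (kernel.ι p)).app X ≫ (S.T.map p).app X = 0 := by
    rw [← NatTrans.comp_app, ← Functor.map_comp, kernel.condition]
    simp
  have : Mono (P.map (S.T.obj F)).f := inferInstanceAs (Mono ((S.T.obj F).map P.f))
  have : Mono φ.τ₃ := inferInstanceAs (Mono ((S.T.flip.obj P.X₃).map (kernel.ι p)))
  have : Epi ψ.τ₁ := inferInstanceAs (Epi ((S.T.flip.obj P.X₁).map p))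
  exact Cotorsion.mono_f_of_columns_exact φ ψ (hφψ P.X₁) (hφψ P.X₂)
    ((ShortComplex.kernelSequence_exact p).map_of_epi_of_preservesCokernel
      (S.T.flip.obj P.X₂) hp inferInstance)
    (hP.exact.map_of_epi_of_preservesCokernel (S.T.obj (kernel p)) ‹_› inferInstance)

lemma shortExact_map_T_of_flat₂ (hflat₁ : Cotorsion.EnoughQuot S.flat₁) {P : ShortComplex A₂}
    (hP : P.ShortExact) (h₃ : S.flat₂ P.X₃) (Q : A₁) : (P.map (S.T.obj Q)).ShortExact := by
  have := hP.epi_g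
  exact .mk' (hP.exact.map_of_epi_of_preservesCokernel _ ‹_› inferInstance)
    (S.mono_T_map_of_flat₂ hflat₁ hP h₃ Q) (inferInstanceAs (Epi ((S.T.obj Q).map P.g)))

lemma rightPerp_flat₂_C (hflat₁ : Cotorsion.EnoughQuot S.flat₁) (Q : A₁) (I : A₃) [Injective I] :
    Cotorsion.rightPerp S.flat₂ ((S.C.obj (op Q)).obj I) :=
  Cotorsion.rightPerp_obj_of_adjunction (S.adjC.adj Q) fun _ hP h₃ φ =>
    have := S.mono_T_map_of_flat₂ hflat₁ hP h₃ Q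
    Injective.factors φ _

lemma shortExact_map_op_C (hflat₂ : Cotorsion.EnoughQuot S.flat₂) (I : A₃) [Injective I]
    {M : ShortComplex A₁} (hM : M.ShortExact) : (M.op.map (S.C.flip.obj I)).ShortExact := by
  have := hM.mono_f
  have := hM.epi_g
  refine .mk' (hM.op.exact.map_of_mono_of_preservesKernel _ hM.op.mono_f inferInstance)
    (inferInstanceAs (Mono ((S.C.flip.obj I).map M.g.op))) ?_
  obtain ⟨F, p, hF, _⟩ := hflat₂ ((S.C.obj (op M.X₁)).obj I)
  have hF' : (S.T.flip.obj F).PreservesMonomorphisms := hF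
  have : Mono ((S.T.map M.f).app F) := inferInstanceAs (Mono ((S.T.flip.obj F).map M.f))
  have fac : S.adjC.homEquiv (Injective.factorThru (S.adjC.homEquiv.symm p)
      ((S.T.map M.f).app F)) ≫ (S.C.map M.f.op).app I = p := by
    rw [← S.adjC.homEquiv_naturality_one, Injective.comp_factorThru, Equiv.apply_symm_apply]
  have : Epi ((S.C.map M.f.op).app I) := epi_of_epi_fac fac
  exact this

lemma flat₂_of_leftPerp (hflat₁ : Cotorsion.EnoughQuot S.flat₁)
    (hflat₂ : Cotorsion.EnoughQuot S.flat₂) [EnoughInjectives A₃] {P : A₂}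
    (hP : Cotorsion.leftPerp (Cotorsion.rightPerp S.flat₂) P) : S.flat₂ P where
  preserves {M N} m _ := by
    have hM : (ShortComplex.mk m (cokernel.π m) (cokernel.condition m)).ShortExact :=
      .mk' (ShortComplex.cokernelSequence_exact m) inferInstance inferInstance
    let incl := Injective.ι ((S.T.obj M).obj P)
    obtain ⟨ψ : P ⟶ (S.C.obj (op N)).obj _, hψ : ψ ≫ (S.C.map m.op).app _ = _⟩ :=
      hP (S.shortExact_map_op_C hflat₂ _ hM) (S.rightPerp_flat₂_C hflat₁ _ _) (S.adjC.homEquiv incl)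
    have fac : (S.T.map m).app P ≫ S.adjC.homEquiv.symm ψ = incl := by
      rw [← S.adjC.homEquiv_symm_naturality_one, hψ, Equiv.symm_apply_apply]
    have : Mono ((S.T.map m).app P) := mono_of_mono_fac fac
    exact this

end Flat

section TotallyAcyclic

variable [HasColimits A₃]

lemma tex_iff {K : ChainComplex A₂ ℤ} : S.tex K ↔ Cotorsion.ex S.flat₂ K ∧
    ∀ E : A₁, Injective E →
      (((S.T.obj E).mapHomologicalComplex (ComplexShape.down ℤ)).obj K).Acyclic :=
  and_congr_right fun _ => forall₂_congr fun E _ =>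
    ⟨fun h n => (h n).of_iso (Cotorsion.mapBifunctorSingleIso S.T E K).symm,
      fun h n => (h n).of_iso (Cotorsion.mapBifunctorSingleIso S.T E K)⟩

lemma rightPerp_tex_single {Y : A₂} {F' : ObjectProperty A₂}
    (hY : Cotorsion.underlineRight S.flat₂ F' Y) (n : ℤ) :
    Cotorsion.rightPerp S.tex ((single A₂ (ComplexShape.down ℤ) n).obj Y) :=
  Cotorsion.rightPerp_single_of_underlineRight (i := n + 1) (k := n - 1) (by simp) (by simp)
    (fun _ hX => hX.1.1 _) (fun _ hX => hX.1.1 _) (fun _ hX => hX.1.2 _) hY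

lemma rightPerp_tex_map_C_single (hflat₁ : Cotorsion.EnoughQuot S.flat₁) (E : A₁) [Injective E]
    (I : A₃) [Injective I] (n : ℤ) :
    Cotorsion.rightPerp S.tex (((S.C.obj (op E)).mapHomologicalComplex (ComplexShape.down ℤ)).obj
      ((single A₃ (ComplexShape.down ℤ) n).obj I)) :=
  Cotorsion.rightPerp_map_single_of_injective (S.adjC.adj E) (i := n + 1) (by simp)
    (fun _ hP hX => shortExact_of_degreewise_shortExact _ fun m =>
      S.shortExact_map_T_of_flat₂ hflat₁ (hP.map_of_exact (eval A₂ _ m)) (hX.1.2 m) E)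
    (fun _ hX => (S.tex_iff.1 hX).2 E inferInstance _) I

variable {S} {X : ChainComplex A₂ ℤ}
  (hX : Cotorsion.leftPerp (Cotorsion.rightPerp S.tex) X)

include hX

lemma acyclic_of_leftPerp {F' : ObjectProperty A₂}
    (hperp : Cotorsion.EnoughSub (Cotorsion.underlineRight S.flat₂ F')) : X.Acyclic := fun n =>
  Cotorsion.exactAt_map_of_leftPerp (Adjunction.id (C := A₂)) (i := n) (j := n - 1) (by simp)
    (by lia) hX (hperp.mono fun _ hY => S.rightPerp_tex_single hY (n - 1))

lemma acyclic_map_T_of_leftPerp (hflat₁ : Cotorsion.EnoughQuot S.flat₁) [EnoughInjectives A₃]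
    (E : A₁) [Injective E] :
    (((S.T.obj E).mapHomologicalComplex (ComplexShape.down ℤ)).obj X).Acyclic := fun n =>
  Cotorsion.exactAt_map_of_leftPerp (S.adjC.adj E) (i := n) (j := n - 1) (by simp) (by lia) hX
    ((Cotorsion.enoughSub_injective A₃).mono fun I (_ : Injective I) =>
      S.rightPerp_tex_map_C_single hflat₁ E I (n - 1))

lemma flat₂_X_of_leftPerp (hflat₁ : Cotorsion.EnoughQuot S.flat₁)
    (hflat₂ : Cotorsion.EnoughQuot S.flat₂) [EnoughInjectives A₃] (n : ℤ) : S.flat₂ (X.X n) :=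
  S.flat₂_of_leftPerp hflat₁ hflat₂ <|
    Cotorsion.leftPerp_X_of_disc (i := n + 1) (by simp) (by simp)
      (fun _ hY => Cotorsion.rightPerp_disc _ _ (fun _ hK => hK.1.2 n) hY) hX

end TotallyAcyclic

end BiadditiveTHC

theorem mainTheorem2_general {A₁ : Type u₁} {A₂ : Type u₂} {A₃ : Type u₃}
    [Category.{v₁} A₁] [Category.{v₂} A₂] [Category.{v₃} A₃]
    [Abelian A₁] [Abelian A₂] [Abelian A₃] [HasColimits A₃] [EnoughInjectives A₃]
    (S : BiadditiveTHC A₁ A₂ A₃)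
    (hflat₁ : Cotorsion.EnoughQuot S.flat₁)
    (hflat₂ : Cotorsion.EnoughQuot S.flat₂)
    (hperp : Cotorsion.EnoughSub
      (Cotorsion.underlineRight S.flat₂ (Cotorsion.rightPerp S.flat₂))) :
    Cotorsion.IsCotorsionTheory S.tex (Cotorsion.rightPerp S.tex) :=
  Cotorsion.isCotorsionTheory_rightPerp fun _ hX =>
    S.tex_iff.2 ⟨⟨BiadditiveTHC.acyclic_of_leftPerp hX hperp,
      BiadditiveTHC.flat₂_X_of_leftPerp hX hflat₁ hflat₂⟩,
      fun E _ => BiadditiveTHC.acyclic_map_T_of_leftPerp hX hflat₁ E⟩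

theorem mainTheorem2 {A₁ : Type u₁} {A₂ : Type u₂} {A₃ : Type u₃}
    [Category.{v₁} A₁] [Category.{v₂} A₂] [Category.{v₃} A₃]
    [Abelian A₁] [Abelian A₂] [Abelian A₃]
    [HasLimits A₁] [HasLimits A₂] [HasColimits A₃]
    (S : BiadditiveTHC A₁ A₂ A₃)
    (hflat₁ : Cotorsion.EnoughQuot S.flat₁)
    (hflat₂ : Cotorsion.EnoughQuot S.flat₂)
    (hinj₃ : EnoughInjectives A₃)
    (hperp : Cotorsion.EnoughSub
      (Cotorsion.underlineRight S.flat₂ (Cotorsion.rightPerp S.flat₂))) :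
    Cotorsion.IsCotorsionTheory S.tex (Cotorsion.rightPerp S.tex) :=
  mainTheorem2_general S hflat₁ hflat₂ hperp
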